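/- Let $a>b>0$ and let $Q=\{(x,y)\in\mathbb{R}^2 : x^2/a+y^2/b=1\}$. For $\lambda\in(0,b)\cup(b,a)$, let $\rho(\lambda)$ be the rotation number of the billiard trajectories inside $Q$ whose caustic is the confocal conic $Q_\lambda=\{x^2/(a-\lambda)+y^2/(b-\lambda)=1\}$, as defined by the frequency map of the billiard, that is, by the quotient of elliptic integrals $$ \rho(\lambda)=\frac{\displaystyle\int_0^{\min(b,\lambda)}\frac{ds}{\sqrt{(\lambda-s)(b-s)(a-s)}}}{\displaystyle 2\int_{\max(b,\lambda)}^{a}\frac{ds}{\sqrt{(\lambda-s)(b-s)(a-s)}}}. $$ Then the rotation function $\rho$ is strictly increasing on the interval $E=(0,b)$, that is, on the set of parameters $\lambda$ for which the caustic $Q_\lambda$ is an ellipse: if $0<\lambda_1<\lambda_2<b$, then $\rho(\lambda_1)<\rho(\lambda_2)$. -/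

import Mathlib

noncomputable section

namespace EllipticBilliard

/-- The cubic `T(s) = (l - s) (b - s) (a - s)` attached to the ellipse `x² / a + y² / b = 1` and to
the confocal caustic `x² / (a - l) + y² / (b - l) = 1`. -/
def cubic (a b l s : ℝ) : ℝ := (l - s) * (b - s) * (a - s)

/-- `K₀ = ∫_0^{min (b, l)} ds / √T(s)`. For `l` in `(0, b) ∪ (b, a)` the cubic is positive on the
open interval of integration, with a simple zero at the upper endpoint, so that the improper
integral converges absolutely and agrees with the Lebesgue integral written here. -/
def period₀ (a b l : ℝ) : ℝ :=
  ∫ s in (0 : ℝ)..(min b l), 1 / √(cubic a b l s)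

/-- `K₁ = ∫_{max (b, l)}^a ds / √T(s)`. For `l` in `(0, b) ∪ (b, a)` the cubic is positive on the
open interval of integration, with simple zeros at the endpoints, so that the improper
integral converges absolutely and agrees with the Lebesgue integral written here. -/
def period₁ (a b l : ℝ) : ℝ :=
  ∫ s in (max b l)..a, 1 / √(cubic a b l s)

/-- The rotation function of the billiard inside the ellipse `x² / a + y² / b = 1`, `a > b > 0`,
on the set `(0, b) ∪ (b, a)` of nonsingular caustic parameters: the frequency map of this billiard,
that is, the solution `ρ` of the linear equation `K₀ - 2 ρ K₁ = 0`. -/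
def rotationFunction (a b l : ℝ) : ℝ := period₀ a b l / (2 * period₁ a b l)

end EllipticBilliard

end

open MeasureTheory Set

namespace EllipticBilliard

/-! A Möbius involution preserving `ds / √T` maps `(b, a)` onto `(-∞, l)`, so `K₁ = J + K₀` with `J
= ∫_{-∞}^0 ds / √T`, and `ρ = (1 - J / K₁) / 2`. This removes `K₀`, whose singular endpoint moves
with `l`. The remaining integrals have fixed domains and can be compared pointwise: as `l` grows,
`T` increases for `s ≤ 0` and decreases on `(b, a)`, so `J` strictly decreases and `K₁` does not
decrease. -/

theorem cubic_pos_of_lt {a b l s : ℝ} (hlb : l < b) (hba : b < a) (hs : s < l) :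
    0 < cubic a b l s :=
  mul_pos (mul_pos (by linarith) (by linarith)) (by linarith)

theorem cubic_pos_of_mem_Ioo {a b l s : ℝ} (hlb : l < b) (hs : s ∈ Ioo b a) :
    0 < cubic a b l s :=
  mul_pos (mul_pos_of_neg_of_neg (by linarith [hs.1]) (by linarith [hs.1])) (by linarith [hs.2])

theorem measurable_inv_sqrt_cubic (a b l : ℝ) : Measurable fun s => 1 / √(cubic a b l s) := by
  unfold cubic
  fun_prop

/-- All three factors of `T` are at least `l - s`, so `(l - s) ^ (-3/2)` dominates. -/
theorem integrableOn_Iic_inv_sqrt_cubic {a b l : ℝ} (hl : 0 < l) (hlb : l < b) (hba : b < a) :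
    IntegrableOn (fun s => 1 / √(cubic a b l s)) (Iic 0) := by
  have h₁ : IntegrableOn (fun s : ℝ => (l - s) ^ (-(3 / 2) : ℝ)) (Iic 0) := by
    have := ((Measure.measurePreserving_sub_left volume l).integrableOn_comp_preimage
      (Homeomorph.subLeft l).measurableEmbedding (f := fun x : ℝ => x ^ (-(3 / 2) : ℝ))
      (s := Ici l)).2 ((integrableOn_Ici_iff_integrableOn_Ioi (by simp)).2
        (integrableOn_Ioi_rpow_of_lt (by norm_num) hl))
    simpa [Function.comp_def] using this
  refine h₁.mono' (measurable_inv_sqrt_cubic a b l).aestronglyMeasurable ?_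
  filter_upwards [ae_restrict_mem measurableSet_Iic] with s hs
  have hs : s ≤ 0 := hs
  have hpos : 0 < l - s := by linarith
  rw [Real.norm_of_nonneg (by positivity), Real.rpow_neg hpos.le, one_div]
  refine inv_anti₀ (by positivity) (Real.le_sqrt_of_sq_le ?_)
  rw [← Real.rpow_natCast, ← Real.rpow_mul hpos.le]
  norm_num
  have : (l - s) ^ 3 = (l - s) * (l - s) * (l - s) := by ring
  rw [this, cubic]
  have h₂ : 0 < b - s := by linarith
  have h₃ : l ≤ a := by linarith
  gcongr

/-- Below the simple zero at `l`, `T` is at least `(l - s) (b - l) (a - l)`. -/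
theorem integrableOn_Ioo_inv_sqrt_cubic {a b l : ℝ} (hl : 0 < l) (hlb : l < b) (hba : b < a) :
    IntegrableOn (fun s => 1 / √(cubic a b l s)) (Ioo 0 l) := by
  have h₁ : IntegrableOn (fun s : ℝ => (l - s) ^ (-(1 / 2) : ℝ)) (Ioo 0 l) := by
    have := (intervalIntegral.intervalIntegrable_rpow' (a := 0) (b := l)
      (r := -(1 / 2)) (by norm_num)).comp_sub_left l
    simp only [sub_zero, sub_self] at this
    exact (intervalIntegrable_iff_integrableOn_Ioo_of_le hl.le).1 this.symm
  have hc : 0 < (b - l) * (a - l) := mul_pos (by linarith) (by linarith)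
  refine (h₁.mul_const (√((b - l) * (a - l)))⁻¹).mono'
    (measurable_inv_sqrt_cubic a b l).aestronglyMeasurable ?_
  filter_upwards [ae_restrict_mem measurableSet_Ioo] with s hs
  have hpos : 0 < l - s := by linarith [hs.2]
  rw [Real.norm_of_nonneg (by positivity), Real.rpow_neg hpos.le, one_div, ← mul_inv,
    ← Real.sqrt_eq_rpow, ← Real.sqrt_mul hpos.le]
  refine inv_anti₀ (Real.sqrt_pos.2 (mul_pos hpos hc)) (Real.sqrt_le_sqrt ?_)
  rw [cubic, mul_assoc]
  have := hs.2
  gcongr <;> linarith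

theorem integrableOn_Iio_inv_sqrt_cubic {a b l : ℝ} (hl : 0 < l) (hlb : l < b) (hba : b < a) :
    IntegrableOn (fun s => 1 / √(cubic a b l s)) (Iio l) := by
  rw [← Iic_union_Ioo_eq_Iio hl]
  exact (integrableOn_Iic_inv_sqrt_cubic hl hlb hba).union
    (integrableOn_Ioo_inv_sqrt_cubic hl hlb hba)

/-- The Möbius involution exchanging `b` with `∞` and `a` with `l`. -/
noncomputable def involution (a b l s : ℝ) : ℝ := b - (a - b) * (b - l) / (s - b)

theorem image_involution {a b l : ℝ} (hlb : l < b) (hba : b < a) :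
    involution a b l '' Ioo b a = Iio l := by
  have hc : 0 < (a - b) * (b - l) := mul_pos (by linarith) (by linarith)
  ext t
  constructor
  · rintro ⟨s, hs, rfl⟩
    have h₁ : 0 < s - b := by linarith [hs.1]
    have : b - l < (a - b) * (b - l) / (s - b) := by
      rw [lt_div_iff₀ h₁]
      nlinarith [hs.2]
    rw [mem_Iio, involution]
    linarith
  · intro ht
    have ht : t < l := ht
    have h₁ : 0 < b - t := by linarith
    -- The map is its own inverse, so the preimage of `t` is its image.
    refine ⟨b + (a - b) * (b - l) / (b - t), ⟨by linarith [div_pos hc h₁], ?_⟩, ?_⟩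
    · have : (a - b) * (b - l) / (b - t) < a - b := by
        rw [div_lt_iff₀ h₁]
        nlinarith
      linarith
    · rw [involution, add_sub_cancel_left, div_div_cancel₀ hc.ne']
      ring

theorem injOn_involution {a b l : ℝ} (hlb : l < b) (hba : b < a) :
    InjOn (involution a b l) (Ioo b a) := by
  have hc : 0 < (a - b) * (b - l) := mul_pos (by linarith) (by linarith)
  intro s _ t _ h
  simp only [involution, sub_right_inj] at h
  have := congrArg (fun x => (a - b) * (b - l) / x) h
  simpa [div_div_cancel₀ hc.ne'] using this

theorem hasDerivAt_involution {a b l s : ℝ} (hs : s ≠ b) :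
    HasDerivAt (involution a b l) ((a - b) * (b - l) / (s - b) ^ 2) s := by
  have h := (((hasDerivAt_id s).sub_const b).inv (sub_ne_zero.2 hs)).const_mul
    ((a - b) * (b - l)) |>.const_sub b
  exact h.congr_deriv (by simp only [id]; ring)

/-- The involution preserves the holomorphic differential `ds / √T(s)`. -/
theorem deriv_mul_inv_sqrt_cubic_involution {a b l s : ℝ} (hlb : l < b) (hs : s ∈ Ioo b a) :
    |(a - b) * (b - l) / (s - b) ^ 2| • (1 / √(cubic a b l (involution a b l s)))
      = 1 / √(cubic a b l s) := by
  have h₁ : 0 < s - b := by linarith [hs.1]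
  have hc : 0 < (a - b) * (b - l) := mul_pos (by linarith [hs.1, hs.2]) (by linarith)
  have hT := cubic_pos_of_mem_Ioo hlb hs
  -- With `σ` the involution, `l - σ = (b - l) (a - s) / (s - b)` and `a - σ = (a - b) (s - l) / (s
  -- - b)`: the factors of `T` are permuted up to scaling, and the total scaling is `σ' ^ 2`.
  have key : cubic a b l (involution a b l s)
      = ((a - b) * (b - l) / (s - b) ^ 2) ^ 2 * cubic a b l s := by
    unfold cubic involution
    field_simp
    ring
  rw [key, Real.sqrt_mul (by positivity), Real.sqrt_sq (by positivity),
    abs_of_pos (by positivity), smul_eq_mul]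
  have := (Real.sqrt_pos.2 hT).ne'
  rw [one_div, mul_inv, ← mul_assoc, mul_inv_cancel₀ (by positivity), one_mul, one_div]

/-- Transferred from the half-line by the involution, with no estimates at the endpoints `a` and
`b`. -/
theorem integrableOn_Ioo_period₁ {a b l : ℝ} (hl : 0 < l) (hlb : l < b) (hba : b < a) :
    IntegrableOn (fun s => 1 / √(cubic a b l s)) (Ioo b a) := by
  have h := integrableOn_Iio_inv_sqrt_cubic hl hlb hba
  rw [← image_involution hlb hba, integrableOn_image_iff_integrableOn_abs_deriv_smul
    measurableSet_Ioo (fun s hs => (hasDerivAt_involution hs.1.ne').hasDerivWithinAt)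
    (injOn_involution hlb hba)] at h
  exact h.congr_fun (fun s hs => deriv_mul_inv_sqrt_cubic_involution hlb hs) measurableSet_Ioo

theorem period₁_eq_integral_Ioo {a b l : ℝ} (hlb : l < b) (hba : b < a) :
    period₁ a b l = ∫ s in Ioo b a, 1 / √(cubic a b l s) := by
  rw [period₁, max_eq_left hlb.le, intervalIntegral.integral_of_le hba.le,
    integral_Ioc_eq_integral_Ioo]

theorem period₁_eq_integral_Iio {a b l : ℝ} (hlb : l < b) (hba : b < a) :
    period₁ a b l = ∫ s in Iio l, 1 / √(cubic a b l s) := by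
  rw [period₁_eq_integral_Ioo hlb hba, ← image_involution hlb hba,
    integral_image_eq_integral_abs_deriv_smul
    measurableSet_Ioo (fun s hs => (hasDerivAt_involution hs.1.ne').hasDerivWithinAt)
    (injOn_involution hlb hba)]
  exact (setIntegral_congr_fun measurableSet_Ioo
    fun s hs => deriv_mul_inv_sqrt_cubic_involution hlb hs).symm

theorem period₁_eq_add_period₀ {a b l : ℝ} (hl : 0 < l) (hlb : l < b) (hba : b < a) :
    period₁ a b l = (∫ s in Iic 0, 1 / √(cubic a b l s)) + period₀ a b l := by
  rw [period₁_eq_integral_Iio hlb hba, ← Iic_union_Ioo_eq_Iio hl,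
    setIntegral_union (by
      rw [Set.disjoint_left]
      exact fun x hx hx' => not_lt.2 hx hx'.1) measurableSet_Ioo
      (integrableOn_Iic_inv_sqrt_cubic hl hlb hba) (integrableOn_Ioo_inv_sqrt_cubic hl hlb hba),
    period₀, min_eq_right hlb.le, intervalIntegral.integral_of_le hl.le,
    integral_Ioc_eq_integral_Ioo]

theorem setIntegral_pos_of_forall_pos {f : ℝ → ℝ} {S : Set ℝ} (hS : MeasurableSet S)
    (hvol : 0 < volume S) (hf : IntegrableOn f S) (hpos : ∀ s ∈ S, 0 < f s) :
    0 < ∫ s in S, f s := by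
  rw [setIntegral_pos_iff_support_of_nonneg_ae
    ((ae_restrict_mem hS).mono fun s hs => (hpos s hs).le) hf,
    inter_eq_right.2 (show S ⊆ Function.support f from fun s hs => (hpos s hs).ne')]
  exact hvol

theorem integral_Iic_inv_sqrt_cubic_pos {a b l : ℝ} (hl : 0 < l) (hlb : l < b) (hba : b < a) :
    0 < ∫ s in Iic 0, 1 / √(cubic a b l s) :=
  setIntegral_pos_of_forall_pos measurableSet_Iic (by simp)
    (integrableOn_Iic_inv_sqrt_cubic hl hlb hba) fun _ hs =>
      one_div_pos.2 (Real.sqrt_pos.2 (cubic_pos_of_lt hlb hba (lt_of_le_of_lt hs hl)))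

theorem integral_Iic_inv_sqrt_cubic_lt {a b l₁ l₂ : ℝ} (hl : 0 < l₁) (h : l₁ < l₂) (hlb : l₂ < b)
    (hba : b < a) :
    ∫ s in Iic 0, 1 / √(cubic a b l₂ s) < ∫ s in Iic 0, 1 / √(cubic a b l₁ s) := by
  have i₁ := integrableOn_Iic_inv_sqrt_cubic hl (h.trans hlb) hba
  have i₂ := integrableOn_Iic_inv_sqrt_cubic (hl.trans h) hlb hba
  rw [← sub_pos, ← integral_sub i₁ i₂]
  refine setIntegral_pos_of_forall_pos measurableSet_Iic (by simp) (i₁.sub i₂) fun s hs => ?_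
  have hs : s ≤ 0 := hs
  have hT := cubic_pos_of_lt (h.trans hlb) hba (lt_of_le_of_lt hs hl)
  refine sub_pos.2 (one_div_lt_one_div_of_lt (Real.sqrt_pos.2 hT) (Real.sqrt_lt_sqrt hT.le ?_))
  unfold cubic
  have h₁ : 0 < b - s := by linarith
  have h₂ : 0 < a - s := by linarith
  gcongr

/-- On `(b, a)`, `T = (s - l) (s - b) (a - s)` with all factors positive, and `l` enters only the
first. -/
theorem period₁_le_period₁ {a b l₁ l₂ : ℝ} (hl : 0 < l₁) (h : l₁ < l₂) (hlb : l₂ < b)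
    (hba : b < a) : period₁ a b l₁ ≤ period₁ a b l₂ := by
  rw [period₁_eq_integral_Ioo (h.trans hlb) hba, period₁_eq_integral_Ioo hlb hba]
  refine setIntegral_mono_on (integrableOn_Ioo_period₁ hl (h.trans hlb) hba)
    (integrableOn_Ioo_period₁ (hl.trans h) hlb hba) measurableSet_Ioo fun s hs => ?_
  refine one_div_le_one_div_of_le (Real.sqrt_pos.2 (cubic_pos_of_mem_Ioo hlb hs))
    (Real.sqrt_le_sqrt ?_)
  have : 0 < (s - b) * (a - s) := mul_pos (by linarith [hs.1]) (by linarith [hs.2])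
  unfold cubic
  nlinarith

theorem period₁_pos {a b l : ℝ} (hl : 0 < l) (hlb : l < b) (hba : b < a) : 0 < period₁ a b l := by
  rw [period₁_eq_integral_Ioo hlb hba]
  exact setIntegral_pos_of_forall_pos measurableSet_Ioo (by simpa using hba)
    (integrableOn_Ioo_period₁ hl hlb hba) fun _ hs =>
      one_div_pos.2 (Real.sqrt_pos.2 (cubic_pos_of_mem_Ioo hlb hs))

theorem rotationFunction_eq {a b l : ℝ} (hl : 0 < l) (hlb : l < b) (hba : b < a) :
    rotationFunction a b l
      = (1 - (∫ s in Iic 0, 1 / √(cubic a b l s)) / period₁ a b l) / 2 := by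
  have hp := (period₁_pos hl hlb hba).ne'
  rw [rotationFunction, eq_sub_of_add_eq' (period₁_eq_add_period₀ hl hlb hba).symm]
  field_simp

end EllipticBilliard

/-- The rotation function of the billiard inside the ellipse `x² / a + y² / b = 1` is (strictly)
increasing on the interval `E = (0, b)` of parameters whose caustics are ellipses. -/
theorem proposition4p4 (a b : ℝ) (hb : 0 < b) (hab : b < a) :
    StrictMonoOn (EllipticBilliard.rotationFunction a b) (Set.Ioo 0 b) := by
  intro l₁ h₁ l₂ h₂ h
  rw [EllipticBilliard.rotationFunction_eq h₁.1 h₁.2 hab,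
    EllipticBilliard.rotationFunction_eq h₂.1 h₂.2 hab]
  have := div_lt_div₀ (EllipticBilliard.integral_Iic_inv_sqrt_cubic_lt h₁.1 h h₂.2 hab)
    (EllipticBilliard.period₁_le_period₁ h₁.1 h h₂.2 hab)
    (EllipticBilliard.integral_Iic_inv_sqrt_cubic_pos h₁.1 h₁.2 hab).le
    (EllipticBilliard.period₁_pos h₁.1 h₁.2 hab)
  linarith
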